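/- Let $\mathcal C$ be a triangulated category, $\Gamma$ a finite rank abelian group and $\mathrm{cl}:K_0(\mathcal C)\to\Gamma$ a homomorphism. Let $(Z,(\mathcal C_\phi)_{\phi\in\mathbb R})$ be a stability condition on $(\mathcal C,\Gamma,\mathrm{cl})$, i.e. an additive map $Z:\Gamma\to\mathbb C$ and full additive (isomorphism-closed) subcategories $\mathcal C_\phi\subset\mathcal C$, $\phi\in\mathbb R$, of "semistable objects of phase $\phi$" (zero included), such that: $\mathcal C_{\phi+1}=\mathcal C_\phi[1]$; $\mathrm{Hom}(E_2,E_1)=0$ if $E_i\in\mathcal C_{\phi_i}$ and $\phi_1<\phi_2$; every $E\in\mathcal C$ has a Harder–Narasimhan filtration, i.e. a tower $0=E_0\to E_1\to\cdots\to E_m\cong E$ with exact triangles $E_{i-1}\to E_i\to A_i\to E_{i-1}[1]$, $0\ne A_i\in\mathcal C_{\psi_i}$, $\psi_1>\cdots>\psi_m$; $Z(\mathrm{cl}(E))\in\mathbb R_{>0}e^{\pi i\phi}$ for $0\neq E\in\mathcal C_\phi$; and there are a norm $\|\cdot\|$ on $\Gamma\otimes_{\mathbb Z}\mathbb R$ and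 $c>0$ with $\|\gamma\|\le c|Z(\gamma)|$ for every class $\gamma\in\Gamma$ of a semistable object. Let $\mathcal A=\mathcal C_{(0,1]}\subset\mathcal C$ be the associated heart, the full subcategory of the objects that have a Harder–Narasimhan filtration with all phases in $(0,1]$; it is an abelian category. Fix phases $0<\phi_1<\phi_2<\cdots<\phi_n\le 1$. Let $A\in\mathcal A$ with a filtration by subobjects in $\mathcal A$, $0=F_0A\subset F_1A\subset\cdots\subset F_nA=A$, such that $F_iA/F_{i-1}A$ is semistable of phase $\phi_i$ for $i=1,\ldots,n$, and let $B\in\mathcal A$ with a filtration $F_iB$ of the same type (same phases). Let $f:A\to B$ be a morphism with $f(F_iA)\subset F_iB$ for all $i$. Then $f$ is strict, i.e. \[ F_iB\cap\mathrm{Im}(f)=f(F_iA)\qquad\text{for all } i . \] -/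

import Mathlib

open CategoryTheory CategoryTheory.Limits CategoryTheory.Pretriangulated
open scoped TensorProduct ZeroObject

namespace BridgelandStability

universe v u

section HarderNarasimhan

variable {C : Type u} [Category.{v} C] [Preadditive C] [HasZeroObject C] [HasShift C ℤ]
  [∀ n : ℤ, (shiftFunctor C n).Additive] [Pretriangulated C]

/-- A Harder–Narasimhan filtration of `E` with respect to a family `P φ`, `φ ∈ ℝ`, of classes
of objects: a tower `0 = E₀ ⟶ E₁ ⟶ ⋯ ⟶ Eₙ ≅ E` completed to distinguished triangles
`Eᵢ ⟶ Eᵢ₊₁ ⟶ Aᵢ₊₁ ⟶ Eᵢ[1]`, whose factors `Aᵢ ≠ 0` are in `P φᵢ`, with `φ₁ > ⋯ > φₙ`. -/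
structure HNFiltration (P : ℝ → ObjectProperty C) (E : C) where
  n : ℕ
  obj : Fin (n + 1) → C
  phase : Fin n → ℝ
  factor : Fin n → C
  isZero_obj_zero : IsZero (obj 0)
  iso : obj (Fin.last n) ≅ E
  phase_strictAnti : StrictAnti phase
  factor_mem : ∀ i, P (phase i) (factor i)
  factor_not_isZero : ∀ i, ¬ IsZero (factor i)
  triangle : ∀ i : Fin n, ∃ (f : obj i.castSucc ⟶ obj i.succ) (g : obj i.succ ⟶ factor i)
    (h : factor i ⟶ (obj i.castSucc)⟦(1 : ℤ)⟧), Triangle.mk f g h ∈ distTriang C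

variable (C) in
/-- The subcategories of semistable objects of a stability condition: full additive
subcategories `P φ` (closed under isomorphisms) for `φ ∈ ℝ`, such that `P (φ + 1) = P φ [1]`,
`Hom (E₂, E₁) = 0` if `Eᵢ ∈ P φᵢ` with `φ₁ < φ₂`, and every object has a
Harder–Narasimhan filtration. -/
structure Slicing where
  P : ℝ → ObjectProperty C
  closedUnderIso : ∀ φ, (P φ).IsClosedUnderIsomorphisms
  zero_mem : ∀ φ, P φ 0
  biprod_mem : ∀ (φ : ℝ) (X Y : C), P φ X → P φ Y → P φ (X ⊞ Y)
  mem_shift_iff : ∀ (φ : ℝ) (X : C), P (φ + 1) (X⟦(1 : ℤ)⟧) ↔ P φ X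
  hom_eq_zero : ∀ (φ₁ φ₂ : ℝ) (E₁ E₂ : C), φ₁ < φ₂ → P φ₁ E₁ → P φ₂ E₂ →
    ∀ f : E₂ ⟶ E₁, f = 0
  exists_hn : ∀ E : C, Nonempty (HNFiltration P E)

namespace Slicing

variable (S : Slicing C)

/-- The full subcategory of the objects which have a Harder–Narasimhan filtration all of whose
phases are contained in `I`. -/
def ofPhases (I : Set ℝ) : ObjectProperty C :=
  fun E => ∃ F : HNFiltration S.P E, ∀ i, F.phase i ∈ I

/-- The heart `C_(0,1]` of the slicing. -/
abbrev heart : ObjectProperty C := S.ofPhases (Set.Ioc 0 1)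

/-! ### The heart is an abelian category -/

variable {S}

lemma ofPhases_mono {I J : Set ℝ} (h : I ⊆ J) {E : C} (hE : S.ofPhases I E) :
    S.ofPhases J E := by
  obtain ⟨F, hF⟩ := hE
  exact ⟨F, fun i => h (hF i)⟩

lemma ofPhases_of_iso {I : Set ℝ} {E E' : C} (e : E ≅ E') (hE : S.ofPhases I E) :
    S.ofPhases I E' := by
  obtain ⟨F, hF⟩ := hE
  exact ⟨{ F with iso := F.iso ≪≫ e }, hF⟩

instance (I : Set ℝ) : (S.ofPhases I).IsClosedUnderIsomorphisms where
  of_iso e h := ofPhases_of_iso e h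

lemma ofPhases_of_isZero (I : Set ℝ) {E : C} (hE : IsZero E) : S.ofPhases I E :=
  ⟨{ n := 0
     obj := fun _ => E
     phase := Fin.elim0
     factor := Fin.elim0
     isZero_obj_zero := hE
     iso := Iso.refl _
     phase_strictAnti := fun i => i.elim0
     factor_mem := fun i => i.elim0
     factor_not_isZero := fun i => i.elim0
     triangle := fun i => i.elim0 }, fun i => i.elim0⟩

instance (I : Set ℝ) : (S.ofPhases I).ContainsZero where
  exists_zero := ⟨0, isZero_zero C, ofPhases_of_isZero I (isZero_zero C)⟩

/-- The statement that there is a distinguished triangle `X ⟶ Y ⟶ Z ⟶ X[1]`. -/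
def IsExt (X Y Z : C) : Prop :=
  ∃ (f : X ⟶ Y) (g : Y ⟶ Z) (h : Z ⟶ X⟦(1 : ℤ)⟧), Triangle.mk f g h ∈ distTriang C

lemma IsExt.of_iso {X X' Y Y' Z : C} (h : IsExt X Y Z) (e : X ≅ X') (e' : Y ≅ Y') :
    IsExt X' Y' Z := by
  obtain ⟨f, g, h, hT⟩ := h
  refine ⟨e.inv ≫ f ≫ e'.hom, e'.inv ≫ g, h ≫ e.hom⟦1⟧', isomorphic_distinguished _ hT _ ?_⟩
  refine Triangle.isoMk _ _ e.symm e'.symm (Iso.refl _) ?_ ?_ ?_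
  · change (e.inv ≫ f ≫ e'.hom) ≫ e'.inv = e.inv ≫ f
    simp
  · change (e'.inv ≫ g) ≫ 𝟙 Z = e'.inv ≫ g
    simp
  · change (h ≫ e.hom⟦1⟧') ≫ e.inv⟦1⟧' = 𝟙 Z ≫ h
    simp [← Functor.map_comp]

lemma ofPhases_snoc {I J : Set ℝ} {E E' A : C} {ψ : ℝ} (hE : S.ofPhases I E)
    (hT : IsExt E E' A) (hA : S.P ψ A) (hA' : ¬ IsZero A) (hI : ∀ x ∈ I, ψ < x)
    (hIJ : I ⊆ J) (hψ : ψ ∈ J) : S.ofPhases J E' := by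
  obtain ⟨F, hF⟩ := hE
  refine ⟨{ n := F.n + 1
            obj := Fin.snoc (α := fun _ => C) F.obj E'
            phase := Fin.snoc (α := fun _ => ℝ) F.phase ψ
            factor := Fin.snoc (α := fun _ => C) F.factor A
            isZero_obj_zero := ?_
            iso := eqToIso (by simp)
            phase_strictAnti := ?_
            factor_mem := ?_
            factor_not_isZero := ?_
            triangle := ?_ }, ?_⟩
  · have : (0 : Fin (F.n + 1 + 1)) = Fin.castSucc 0 := rfl
    rw [this, Fin.snoc_castSucc]
    exact F.isZero_obj_zero
  · intro i j hij
    induction j using Fin.lastCases with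
    | last =>
      induction i using Fin.lastCases with
      | last => exact absurd hij (lt_irrefl _)
      | cast i => simpa using hI _ (hF i)
    | cast j =>
      induction i using Fin.lastCases with
      | last => exact absurd hij (not_lt.2 (Fin.le_last _))
      | cast i => simpa using F.phase_strictAnti (Fin.castSucc_lt_castSucc_iff.1 hij)
  · intro i
    induction i using Fin.lastCases with
    | last => simpa using hA
    | cast i => simpa using F.factor_mem i
  · intro i
    induction i using Fin.lastCases with
    | last => simpa using hA'
    | cast i => simpa using F.factor_not_isZero i
  · intro i
    change IsExt _ _ _
    induction i using Fin.lastCases with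
    | last =>
      rw [Fin.snoc_castSucc, Fin.succ_last, Fin.snoc_last, Fin.snoc_last]
      exact hT.of_iso F.iso.symm (Iso.refl _)
    | cast i =>
      rw [Fin.snoc_castSucc, Fin.succ_castSucc, Fin.snoc_castSucc, Fin.snoc_castSucc]
      exact F.triangle i
  · intro i
    induction i using Fin.lastCases with
    | last => simpa using hψ
    | cast i => simpa using hIJ (hF i)

/-- Induction on the length of a Harder–Narasimhan filtration. -/
lemma ofPhases_induction {motive : Set ℝ → C → Prop}
    (zero : ∀ I E, IsZero E → motive I E)
    (step : ∀ (I : Set ℝ) (E' E A : C) (ψ : ℝ), ψ ∈ I → S.P ψ A → ¬ IsZero A →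
      IsExt E' E A → S.ofPhases (I ∩ Set.Ioi ψ) E' → motive (I ∩ Set.Ioi ψ) E' → motive I E)
    {I : Set ℝ} {E : C} (hE : S.ofPhases I E) : motive I E := by
  obtain ⟨F, hF⟩ := hE
  obtain ⟨n, hn⟩ : ∃ n, F.n = n := ⟨_, rfl⟩
  induction n generalizing I E with
  | zero =>
    obtain ⟨n, obj, phase, factor, h0, e, h1, h2, h3, h4⟩ := F
    subst hn
    exact zero _ _ (h0.of_iso e.symm)
  | succ n ih =>
    obtain ⟨m, obj, phase, factor, h0, e, h1, h2, h3, h4⟩ := F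
    subst hn
    let F' : HNFiltration S.P (obj (Fin.last n).castSucc) :=
      { n := n
        obj := fun i => obj i.castSucc
        phase := fun i => phase i.castSucc
        factor := fun i => factor i.castSucc
        isZero_obj_zero := h0
        iso := Iso.refl _
        phase_strictAnti := fun i j hij => h1 (Fin.castSucc_lt_castSucc_iff.2 hij)
        factor_mem := fun i => h2 _
        factor_not_isZero := fun i => h3 _
        triangle := fun i => h4 i.castSucc }
    have hF' : ∀ i, F'.phase i ∈ I ∩ Set.Ioi (phase (Fin.last n)) :=
      fun i => ⟨hF i.castSucc, h1 (Fin.castSucc_lt_last i)⟩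
    exact step I _ E _ _ (hF (Fin.last n)) (h2 _) (h3 _)
      (IsExt.of_iso (h4 (Fin.last n)) (Iso.refl _) e) ⟨F', hF'⟩ (ih F' hF' rfl)

lemma IsExt.hom_from_eq_zero {X Y Z W : C} (h : IsExt X Y Z) (hX : ∀ f : X ⟶ W, f = 0)
    (hZ : ∀ f : Z ⟶ W, f = 0) (f : Y ⟶ W) : f = 0 := by
  obtain ⟨a, b, c, hT⟩ := h
  obtain ⟨g, hg⟩ := Triangle.yoneda_exact₂ _ hT f (hX _)
  exact hg.trans ((congrArg (b ≫ ·) (hZ g)).trans comp_zero)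

lemma IsExt.hom_to_eq_zero {X Y Z W : C} (h : IsExt X Y Z) (hX : ∀ f : W ⟶ X, f = 0)
    (hZ : ∀ f : W ⟶ Z, f = 0) (f : W ⟶ Y) : f = 0 := by
  obtain ⟨a, b, c, hT⟩ := h
  obtain ⟨g, hg⟩ := Triangle.coyoneda_exact₂ _ hT f (hZ _)
  exact hg.trans ((congrArg (· ≫ a) (hX g)).trans zero_comp)

lemma hom_eq_zero_of_ofPhases {I J : Set ℝ} (hIJ : ∀ x ∈ I, ∀ y ∈ J, y < x) {X Y : C}
    (hX : S.ofPhases I X) (hY : S.ofPhases J Y) (f : X ⟶ Y) : f = 0 := by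
  have key : ∀ (ψ : ℝ) (B : C), S.P ψ B → ∀ {I : Set ℝ} {X : C}, S.ofPhases I X →
      (∀ x ∈ I, ψ < x) → ∀ f : X ⟶ B, f = 0 := by
    intro ψ B hB I X hX
    refine ofPhases_induction
      (motive := fun I X => (∀ x ∈ I, ψ < x) → ∀ f : X ⟶ B, f = 0) ?_ ?_ hX
    · intro I E hE _ f
      exact hE.eq_of_src _ _
    · intro I E' E A φ hφ hA _ hT _ ih hI
      exact hT.hom_from_eq_zero (ih fun x hx => hI x hx.1)
        (S.hom_eq_zero _ _ _ _ (hI _ hφ) hB hA)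
  revert f
  refine ofPhases_induction
    (motive := fun J Y => (∀ x ∈ I, ∀ y ∈ J, y < x) → ∀ f : X ⟶ Y, f = 0) ?_ ?_ hY hIJ
  · intro J E hE _ f
    exact hE.eq_of_tgt _ _
  · intro J E' E A φ hφ hA _ hT _ ih hJ
    exact hT.hom_to_eq_zero (ih fun x hx y hy => hJ x hx y hy.1)
      (key φ A hA hX fun x hx => hJ x hx φ hφ)

lemma P_shift (φ : ℝ) (X : C) (hX : S.P φ X) (n : ℤ) : S.P (φ + n) (X⟦n⟧) := by
  have := S.closedUnderIso
  induction n using Int.induction_on with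
  | zero =>
    have := (S.P φ).prop_of_iso ((shiftFunctorZero C ℤ).symm.app X) hX
    simpa using this
  | succ n ih =>
    have := (S.mem_shift_iff _ _).2 ih
    have := (S.P _).prop_of_iso ((shiftFunctorAdd' C (n : ℤ) 1 (n + 1) rfl).symm.app X) this
    convert this using 1
    push_cast
    ring
  | pred n ih =>
    have : S.P (φ + ((-n : ℤ) : ℝ)) ((X⟦-(n : ℤ) - 1⟧)⟦(1 : ℤ)⟧) := (S.P _).prop_of_iso
      ((shiftFunctorAdd' C (-(n : ℤ) - 1) 1 (-n) (by ring)).app X) ih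
    refine (S.mem_shift_iff _ _).1 ?_
    convert this using 1
    push_cast
    ring

lemma IsExt.shift {X Y Z : C} (h : IsExt X Y Z) (n : ℤ) : IsExt (X⟦n⟧) (Y⟦n⟧) (Z⟦n⟧) := by
  obtain ⟨f, g, h, hT⟩ := h
  exact ⟨_, _, _, Triangle.shift_distinguished _ hT n⟩

lemma IsExt.rotate {X Y Z : C} (h : IsExt X Y Z) : IsExt Y Z (X⟦(1 : ℤ)⟧) := by
  obtain ⟨f, g, h, hT⟩ := h
  exact ⟨_, _, _, rot_of_distTriang _ hT⟩

lemma IsExt.invRotate {X Y Z : C} (h : IsExt X Y Z) : IsExt (Z⟦(-1 : ℤ)⟧) X Y := by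
  obtain ⟨f, g, h, hT⟩ := h
  exact ⟨_, _, _, inv_rot_of_distTriang _ hT⟩

lemma ofPhases_shift {I J : Set ℝ} (n : ℤ) (hIJ : ∀ x ∈ I, x + n ∈ J) {X : C}
    (hX : S.ofPhases I X) : S.ofPhases J (X⟦n⟧) := by
  obtain ⟨F, hF⟩ := hX
  exact ⟨{ n := F.n
           obj := fun i => (F.obj i)⟦n⟧
           phase := fun i => F.phase i + n
           factor := fun i => (F.factor i)⟦n⟧
           isZero_obj_zero := Functor.map_isZero _ F.isZero_obj_zero
           iso := (shiftFunctor C n).mapIso F.iso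
           phase_strictAnti := fun i j hij => by
             have := F.phase_strictAnti hij
             dsimp only
             linarith
           factor_mem := fun i => P_shift _ _ (F.factor_mem i) n
           factor_not_isZero := fun i h => F.factor_not_isZero i <| by
             rw [IsZero.iff_id_eq_zero] at h ⊢
             apply (shiftFunctor C n).map_injective
             rw [CategoryTheory.Functor.map_id, CategoryTheory.Functor.map_zero]
             exact h
           triangle := fun i => IsExt.shift (F.triangle i) n }, fun i => hIJ _ (hF i)⟩

lemma iso_of_isExt_of_hom_eq_zero {X E Y : C} (h : IsExt X E Y) (h₁ : ∀ f : E ⟶ Y, f = 0)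
    (h₂ : ∀ f : X⟦(1 : ℤ)⟧ ⟶ Y, f = 0) : Nonempty (X ≅ E) := by
  have hY : IsZero Y := by
    rw [IsZero.iff_id_eq_zero]
    exact h.rotate.hom_from_eq_zero h₁ h₂ _
  obtain ⟨f, g, k, hT⟩ := h
  have : IsIso f := (Triangle.isZero₃_iff_isIso₁ _ hT).1 hY
  exact ⟨asIso f⟩

lemma iso_of_isExt_of_hom_eq_zero' {X E Y : C} (h : IsExt X E Y) (h₁ : ∀ f : X ⟶ E, f = 0)
    (h₂ : ∀ f : X ⟶ Y⟦(-1 : ℤ)⟧, f = 0) : Nonempty (E ≅ Y) := by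
  have hX : IsZero X := by
    rw [IsZero.iff_id_eq_zero]
    exact h.invRotate.hom_to_eq_zero h₂ h₁ _
  obtain ⟨f, g, k, hT⟩ := h
  have : IsIso g := (Triangle.isZero₁_iff_isIso₂ _ hT).1 hX
  exact ⟨asIso g⟩

variable (S) in
lemma heart_hom_shift_eq_zero ⦃X Y : S.heart.FullSubcategory⦄ ⦃n : ℤ⦄
    (f : S.heart.ι.obj X ⟶ (S.heart.ι.obj Y)⟦n⟧) (hn : n < 0) : f = 0 := by
  refine hom_eq_zero_of_ofPhases (S := S) (I := Set.Ioc 0 1) (J := Set.Iic 0) ?_ X.property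
    (ofPhases_shift n ?_ Y.property) f
  · intro x hx y hy
    exact lt_of_le_of_lt hy hx.1
  · intro x hx
    have : (n : ℝ) ≤ -1 := by exact_mod_cast Int.le_sub_one_of_lt hn
    simp only [Set.mem_Iic]
    linarith [hx.2]

section Triangulated

variable [IsTriangulated C]

lemma IsExt.octahedron {X Y Z A B : C} {a : X ⟶ Y} {b : Y ⟶ A} {c : A ⟶ X⟦(1 : ℤ)⟧}
    (h : Triangle.mk a b c ∈ distTriang C) (h' : IsExt Y Z B) :
    ∃ (D : C) (b' : Z ⟶ D) (a' : X ⟶ Z) (c' : D ⟶ X⟦(1 : ℤ)⟧),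
      Triangle.mk a' b' c' ∈ distTriang C ∧ IsExt A D B := by
  obtain ⟨f, g, k, hT⟩ := h'
  obtain ⟨D, b', c', hD⟩ := distinguished_cocone_triangle (a ≫ f)
  have H := Triangulated.someOctahedron rfl h hT hD
  exact ⟨D, b', a ≫ f, c', hD, _, _, _, H.mem⟩

/-- Truncation of an object at the phase `t`. -/
lemma exists_truncation (t : ℝ) {I : Set ℝ} {E : C} (hE : S.ofPhases I E) :
    ∃ X Y, S.ofPhases (I ∩ Set.Ioi t) X ∧ S.ofPhases (I ∩ Set.Iic t) Y ∧ IsExt X E Y := by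
  refine ofPhases_induction (motive := fun I E => ∃ X Y, S.ofPhases (I ∩ Set.Ioi t) X ∧
    S.ofPhases (I ∩ Set.Iic t) Y ∧ IsExt X E Y) ?_ ?_ hE
  · intro I E hE
    exact ⟨E, 0, ofPhases_of_isZero _ hE, ofPhases_of_isZero _ (isZero_zero C),
      _, _, _, contractible_distinguished E⟩
  · intro I E' E A ψ hψ hA hA' hT hE' ih
    by_cases h : t < ψ
    · refine ⟨E, 0, ?_, ofPhases_of_isZero _ (isZero_zero C),
        _, _, _, contractible_distinguished E⟩
      exact ofPhases_snoc hE' hT hA hA' (fun x hx => hx.2)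
        (fun x hx => ⟨hx.1, h.trans hx.2⟩) ⟨hψ, h⟩
    · obtain ⟨X, Y, hX, hY, a, b, c, hT'⟩ := ih
      obtain ⟨D, b', a', c', hD, hAD⟩ := IsExt.octahedron hT' hT
      refine ⟨X, D, ofPhases_mono (I := (I ∩ Set.Ioi ψ) ∩ Set.Ioi t)
        (fun x hx => And.intro hx.1.1 hx.2) hX, ?_, a', b', c', hD⟩
      exact ofPhases_snoc hY hAD hA hA' (fun x hx => hx.1.2)
        (fun x hx => ⟨hx.1.1, hx.2⟩) ⟨hψ, not_lt.1 h⟩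

lemma exists_truncation' (t : ℝ) (E : C) :
    ∃ X Y, S.ofPhases (Set.Ioi t) X ∧ S.ofPhases (Set.Iic t) Y ∧ IsExt X E Y := by
  obtain ⟨F⟩ := S.exists_hn E
  obtain ⟨X, Y, hX, hY, h⟩ := exists_truncation t (I := Set.univ) ⟨F, fun _ => trivial⟩
  exact ⟨X, Y, ofPhases_mono (fun x hx => hx.2) hX, ofPhases_mono (fun x hx => hx.2) hY, h⟩

lemma ofPhases_Ioi_iff (t : ℝ) (E : C) :
    S.ofPhases (Set.Ioi t) E ↔ ∀ Y, S.ofPhases (Set.Iic t) Y → ∀ f : E ⟶ Y, f = 0 := by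
  constructor
  · intro hE Y hY
    exact hom_eq_zero_of_ofPhases (fun x hx y hy => lt_of_le_of_lt hy hx) hE hY
  · intro h
    obtain ⟨X, Y, hX, hY, hT⟩ := exists_truncation' (S := S) t E
    obtain ⟨e⟩ := iso_of_isExt_of_hom_eq_zero hT (h Y hY)
      (hom_eq_zero_of_ofPhases (fun x hx y hy => lt_of_le_of_lt hy hx)
        (ofPhases_shift 1 (J := Set.Ioi t) (fun x hx => by
          simp only [Set.mem_Ioi, Int.cast_one] at hx ⊢; linarith) hX) hY)
    exact ofPhases_of_iso e hX

lemma ofPhases_Iic_iff (t : ℝ) (E : C) :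
    S.ofPhases (Set.Iic t) E ↔ ∀ X, S.ofPhases (Set.Ioi t) X → ∀ f : X ⟶ E, f = 0 := by
  constructor
  · intro hE X hX
    exact hom_eq_zero_of_ofPhases (fun x hx y hy => lt_of_le_of_lt hy hx) hX hE
  · intro h
    obtain ⟨X, Y, hX, hY, hT⟩ := exists_truncation' (S := S) t E
    obtain ⟨e⟩ := iso_of_isExt_of_hom_eq_zero' hT (h X hX)
      (hom_eq_zero_of_ofPhases (fun x hx y hy => lt_of_le_of_lt hy hx) hX
        (ofPhases_shift (-1) (J := Set.Iic t) (fun x hx => by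
          simp only [Set.mem_Iic, Int.cast_neg, Int.cast_one] at hx ⊢; linarith) hY))
    exact ofPhases_of_iso e.symm hY

lemma ofPhases_Ioc_iff (s t : ℝ) (E : C) :
    S.ofPhases (Set.Ioc s t) E ↔ S.ofPhases (Set.Ioi s) E ∧ S.ofPhases (Set.Iic t) E := by
  constructor
  · intro h
    exact ⟨ofPhases_mono (fun x hx => hx.1) h, ofPhases_mono (fun x hx => hx.2) h⟩
  · rintro ⟨h₁, h₂⟩
    obtain ⟨X, Y, hX, hY, hT⟩ := exists_truncation s h₂
    have hX' := ofPhases_mono (S := S) (J := Set.Ioi s) (fun x hx => hx.2) hX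
    have hY' := ofPhases_mono (S := S) (J := Set.Iic s) (fun x hx => hx.2) hY
    obtain ⟨e⟩ := iso_of_isExt_of_hom_eq_zero hT ((ofPhases_Ioi_iff s E).1 h₁ Y hY')
      (hom_eq_zero_of_ofPhases (fun x hx y hy => lt_of_le_of_lt hy hx)
        (ofPhases_shift 1 (J := Set.Ioi s) (fun x hx => by
          simp only [Set.mem_Ioi, Int.cast_one] at hx ⊢; linarith) hX') hY')
    exact ofPhases_of_iso e (ofPhases_mono (I := Set.Iic t ∩ Set.Ioi s)
      (fun x hx => And.intro hx.2 hx.1) hX)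

lemma IsExt.Ioi_mem {X Y Z : C} (h : IsExt X Y Z) {t : ℝ} (hX : S.ofPhases (Set.Ioi t) X)
    (hZ : S.ofPhases (Set.Ioi t) Z) : S.ofPhases (Set.Ioi t) Y := by
  rw [ofPhases_Ioi_iff] at hX hZ ⊢
  exact fun W hW => h.hom_from_eq_zero (hX W hW) (hZ W hW)

lemma IsExt.Iic_mem {X Y Z : C} (h : IsExt X Y Z) {t : ℝ} (hX : S.ofPhases (Set.Iic t) X)
    (hZ : S.ofPhases (Set.Iic t) Z) : S.ofPhases (Set.Iic t) Y := by
  rw [ofPhases_Iic_iff] at hX hZ ⊢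
  exact fun W hW => h.hom_to_eq_zero (hX W hW) (hZ W hW)

variable (S)

instance : S.heart.IsClosedUnderBinaryProducts where
  limitsOfShape_le := by
    rintro X ⟨p⟩
    refine S.heart.prop_of_iso (IsLimit.conePointUniqueUpToIso (prodIsProd _ _)
      ((IsLimit.postcomposeHomEquiv (diagramIsoPair p.diag) _).2 p.isLimit)) ?_
    have hT : IsExt (p.diag.obj ⟨.left⟩) (p.diag.obj ⟨.left⟩ ⨯ p.diag.obj ⟨.right⟩)
      (p.diag.obj ⟨.right⟩) := ⟨_, _, _, binaryProductTriangle_distinguished _ _⟩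
    have h₁ := (ofPhases_Ioc_iff _ _ _).1 (p.prop_diag_obj ⟨.left⟩)
    have h₂ := (ofPhases_Ioc_iff _ _ _).1 (p.prop_diag_obj ⟨.right⟩)
    exact (ofPhases_Ioc_iff _ _ _).2 ⟨hT.Ioi_mem h₁.1 h₂.1, hT.Iic_mem h₁.2 h₂.2⟩

instance : S.heart.IsClosedUnderFiniteProducts := .mk'

instance : S.heart.ι.Additive where

lemma heart_admissible :
    Triangulated.AbelianSubcategory.admissibleMorphism S.heart.ι = ⊤ := by
  ext X₁ X₂ f
  simp only [MorphismProperty.top_apply, iff_true]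
  intro X₃ f₂ f₃ hT
  have hE : IsExt X₂.obj X₃ (X₁.obj⟦(1 : ℤ)⟧) := ⟨_, _, _, rot_of_distTriang _ hT⟩
  have h₁ := (ofPhases_Ioc_iff _ _ _).1 X₁.property
  have h₂ := (ofPhases_Ioc_iff _ _ _).1 X₂.property
  have h₃ : S.ofPhases (Set.Ioi 0) X₃ := hE.Ioi_mem h₂.1
    (ofPhases_shift 1 (fun x hx => by
      simp only [Set.mem_Ioi, Int.cast_one] at hx ⊢; linarith) h₁.1)
  have h₃' : S.ofPhases (Set.Iic 2) X₃ := hE.Iic_mem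
    (ofPhases_mono (Set.Iic_subset_Iic.2 one_le_two) h₂.2)
    (ofPhases_shift 1 (fun x hx => by
      simp only [Set.mem_Iic, Int.cast_one] at hx ⊢; linarith) h₁.2)
  obtain ⟨U, Q, hU, hQ, hUQ⟩ := exists_truncation (S := S) 1
    ((ofPhases_Ioc_iff 0 2 X₃).2 ⟨h₃, h₃'⟩)
  have hK : S.heart (U⟦(-1 : ℤ)⟧) := ofPhases_shift (-1) (fun x hx => by
    obtain ⟨⟨-, h⟩, h'⟩ := hx
    simp only [Set.mem_Ioi, Set.mem_Ioc, Int.cast_neg, Int.cast_one] at h h' ⊢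
    constructor <;> linarith) hU
  have hQ' : S.heart Q := ofPhases_mono (I := Set.Ioc 0 2 ∩ Set.Iic 1)
    (fun x hx => And.intro hx.1.1 hx.2) hQ
  have e : U ≅ (U⟦(-1 : ℤ)⟧)⟦(1 : ℤ)⟧ :=
    (shiftFunctorCompIsoId C (-1 : ℤ) 1 (by norm_num)).symm.app U
  obtain ⟨α, β, γ, h⟩ := hUQ.of_iso e (Iso.refl _)
  exact ⟨⟨_, hK⟩, ⟨_, hQ'⟩, α, β, γ, h⟩

/-- The heart of a slicing is an abelian category. -/
noncomputable instance heartAbelian : Abelian S.heart.FullSubcategory :=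
  Triangulated.AbelianSubcategory.abelian S.heart.ι (heart_hom_shift_eq_zero S)
    (heart_admissible S)

end Triangulated

end Slicing

end HarderNarasimhan

section StabilityConditions

variable (C : Type u) [Category.{v} C] [Preadditive C] [HasZeroObject C] [HasShift C ℤ]
  [∀ n : ℤ, (shiftFunctor C n).Additive] [Pretriangulated C]

/-- The relations `[Y] = [X] + [Z]` for distinguished triangles `X ⟶ Y ⟶ Z ⟶ X[1]`. -/
def K0Relations : Set (FreeAbelianGroup C) :=
  { r | ∃ T ∈ distTriang C, r = FreeAbelianGroup.of T.obj₂ -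
      (FreeAbelianGroup.of T.obj₁ + FreeAbelianGroup.of T.obj₃) }

/-- The Grothendieck group of a triangulated category. -/
abbrev K0 : Type u := FreeAbelianGroup C ⧸ AddSubgroup.closure (K0Relations C)

variable {C} in
/-- The class of an object in the Grothendieck group. -/
def K0.of (X : C) : K0 C := QuotientAddGroup.mk (FreeAbelianGroup.of X)

variable {C} in
/-- A stability condition for `(C, Γ, cl)`: a central charge `Z : Γ → ℂ` and a slicing, with
`Z (E) ∈ ℝ_{>0} e^{π i φ}` for nonzero semistable `E` of phase `φ`, and with the support
property `‖γ‖ ≤ c |Z γ|` on classes of semistable objects, for some norm on `Γ ⊗ ℝ`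
(a norm being a seminorm that vanishes only at `0`) and some `c > 0`. -/
structure StabilityCondition {Γ : Type*} [AddCommGroup Γ] (cl : K0 C →+ Γ) extends
    Slicing C where
  Z : Γ →+ ℂ
  charge : ∀ (φ : ℝ) (E : C), P φ E → ¬ IsZero E →
    ∃ r : ℝ, 0 < r ∧ Z (cl (K0.of E)) = r * Complex.exp (Real.pi * Complex.I * φ)
  support : ∃ (N : Seminorm ℝ (ℝ ⊗[ℤ] Γ)) (c : ℝ), (∀ x, N x = 0 → x = 0) ∧ 0 < c ∧
    ∀ (φ : ℝ) (E : C), P φ E →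
      N ((1 : ℝ) ⊗ₜ[ℤ] cl (K0.of E)) ≤ c * ‖Z (cl (K0.of E))‖

variable {C} [IsTriangulated C]

/-- A filtration `0 = F₀A ⊆ F₁A ⊆ ⋯ ⊆ FₙA = A` by subobjects in the heart `C_(0,1]`, such that
`FᵢA / Fᵢ₋₁A` is semistable of phase `φᵢ` (here `φ₁, …, φₙ` are indexed by `Fin n`). -/
structure SemistableFiltration {Γ : Type*} [AddCommGroup Γ] {cl : K0 C →+ Γ}
    (σ : StabilityCondition cl) {n : ℕ} (φ : Fin n → ℝ) (A : σ.heart.FullSubcategory) where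
  F : Fin (n + 1) → Subobject A
  mono : Monotone F
  zero : F 0 = ⊥
  last : F (Fin.last n) = ⊤
  semistable : ∀ i : Fin n,
    σ.P (φ i) (cokernel ((F i.castSucc).ofLE (F i.succ) (mono (Fin.castSucc_le_succ i)))).obj

end StabilityConditions

end BridgelandStability

/-! Put `Q i = coker (F_i A ⟶ F_i B)`. Strictness follows once every `Q i ⟶ coker f` is a
monomorphism: what lies in `F_i B` and in `Im f` dies in `coker f`, hence in `Q i`, hence comes from
`F_i A`. By the snake lemma, the kernel of `Q i ⟶ Q (i+1)` is the image of the connecting morphism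
to `Q i` from the kernel of the map between the next graded pieces. Now `Q i` is built from
cokernels of maps between graded pieces of smaller phase, so it suffices that `Hom (ker u, coker v)
= 0` for `u` between semistable objects of phase `t` and `v` between semistable objects of phase `s
< t`. The phases increase along the filtration, opposite to the Harder–Narasimhan order, and this is
what makes these groups vanish. The formal part is `filtration_strict`.

The vanishing holds because `ker u` has only phases above `s` (`kernel_ofPhases_Ioi`) and `coker v`
only phases at most `s` (`cokernel_ofPhases_Iic`). Either failure would produce an object lying on
one side of a ray by its phases, while its central charge, computed from an extension, lies strictly
on the other side. The numerical tool is `rotatedIm`, the signed height of the central charge over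
the line of a given phase. -/

namespace CategoryTheory.Abelian

/-! ### Strictness of filtered morphisms in an abelian category -/

variable {𝒜 : Type*} [Category* 𝒜] [Abelian 𝒜]

/-- In a morphism of short exact sequences, the map between the cokernels of the first two
components is a monomorphism if every morphism from the kernel of the third component to the
cokernel of the first one is zero. -/
lemma mono_cokernelMap_of_hom_eq_zero {S T : ShortComplex 𝒜} (hS : S.ShortExact)
    (hT : T.ShortExact) (φ : S ⟶ T) (h : ∀ g : kernel φ.τ₃ ⟶ cokernel φ.τ₁, g = 0) :
    Mono (cokernel.map φ.τ₁ φ.τ₂ S.f T.f φ.comm₁₂) := by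
  have := hS.mono_f
  have := hS.epi_g
  have := hT.mono_f
  let p₁ : pullback S.g (kernel.ι φ.τ₃) ⟶ S.X₂ := pullback.fst _ _
  let p₂ : pullback S.g (kernel.ι φ.τ₃) ⟶ kernel φ.τ₃ := pullback.snd _ _
  have hp : p₁ ≫ S.g = p₂ ≫ kernel.ι φ.τ₃ := pullback.condition
  -- The snake construction: `e` descends along `p₂` to the connecting morphism from `kernel φ.τ₃`
  -- to `cokernel φ.τ₁`, which is zero by `h`.
  obtain ⟨e, he⟩ : ∃ e : pullback S.g (kernel.ι φ.τ₃) ⟶ T.X₁, e ≫ T.f = p₁ ≫ φ.τ₂ :=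
    ⟨hT.exact.lift (p₁ ≫ φ.τ₂) (by
      rw [Category.assoc, φ.comm₂₃, reassoc_of% hp, kernel.condition, comp_zero]),
      hT.exact.lift_f _ _⟩
  have he' : e ≫ cokernel.π φ.τ₁ = 0 := by
    have key : kernel.ι p₂ ≫ e ≫ cokernel.π φ.τ₁ = 0 := by
      have h₁ : (kernel.ι p₂ ≫ p₁) ≫ S.g = 0 := by
        rw [Category.assoc, hp, kernel.condition_assoc, zero_comp]
      have h₂ : kernel.ι p₂ ≫ e = hS.exact.lift _ h₁ ≫ φ.τ₁ := by
        rw [← cancel_mono T.f, Category.assoc, Category.assoc, he, φ.comm₁₂,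
          hS.exact.lift_f_assoc, Category.assoc]
      rw [reassoc_of% h₂, cokernel.condition, comp_zero]
    have hd : p₂ ≫ Abelian.epiDesc p₂ _ key = e ≫ cokernel.π φ.τ₁ :=
      Abelian.comp_epiDesc p₂ _ key
    rw [← hd, h (Abelian.epiDesc p₂ _ key), comp_zero]
  rw [Preadditive.mono_iff_cancel_zero]
  intro W z hz
  obtain ⟨W₁, π₁, _, y, hy⟩ := surjective_up_to_refinements_of_epi (cokernel.π φ.τ₁) z
  have hy' : (y ≫ T.f) ≫ cokernel.π φ.τ₂ = 0 := by
    have := π₁ ≫= hz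
    rw [reassoc_of% hy, cokernel.map, cokernel.π_desc, comp_zero] at this
    rw [Category.assoc, this]
  obtain ⟨W₂, π₂, _, x, hx⟩ :=
    (CokernelCofork.IsColimit.comp_π_eq_zero_iff_up_to_refinements
      (cokernelIsCokernel φ.τ₂) (y ≫ T.f)).1 hy'
  have hx' : (x ≫ S.g) ≫ φ.τ₃ = 0 := by
    rw [Category.assoc, ← φ.comm₂₃, ← reassoc_of% hx, T.zero, comp_zero, comp_zero]
  -- The pair of `x` and its image in the kernel of `φ.τ₃` exhibits `z`, up to refinement, as a
  -- value of the connecting morphism.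
  let w : W₂ ⟶ pullback S.g (kernel.ι φ.τ₃) := pullback.lift x (kernel.lift _ _ hx') (by simp)
  have hw : w ≫ e = π₂ ≫ y := by
    rw [← cancel_mono T.f, Category.assoc, Category.assoc, he, hx, pullback.lift_fst_assoc]
  rw [← cancel_epi π₁, ← cancel_epi π₂, hy, ← reassoc_of% hw, he', comp_zero, comp_zero, comp_zero]

/-- In a morphism of short exact sequences such that the map between the cokernels of the first
two components is a monomorphism, a vanishing of morphisms to the cokernels of the outer
components implies a vanishing of morphisms to the cokernel of the middle one. -/
lemma hom_cokernel_eq_zero {S T : ShortComplex 𝒜} (hT : T.ShortExact) [Epi S.g] (φ : S ⟶ T)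
    [Mono (cokernel.map φ.τ₁ φ.τ₂ S.f T.f φ.comm₁₂)] {W : 𝒜}
    (h₁ : ∀ g : W ⟶ cokernel φ.τ₁, g = 0) (h₃ : ∀ g : W ⟶ cokernel φ.τ₃, g = 0)
    (g : W ⟶ cokernel φ.τ₂) : g = 0 := by
  let c := cokernel.map φ.τ₁ φ.τ₂ S.f T.f φ.comm₁₂
  let d := cokernel.map φ.τ₂ φ.τ₃ S.g T.g φ.comm₂₃
  have hcd : c ≫ d = 0 := by
    rw [← cancel_epi (cokernel.π φ.τ₁)]
    simp [c, d]
  -- Right exactness of the cokernel sequence, by a diagram chase; with `c` mono, a map killed by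
  -- `d` lifts to `cokernel φ.τ₁`.
  have hex : (ShortComplex.mk c d hcd).Exact := by
    rw [ShortComplex.exact_iff_exact_up_to_refinements]
    intro V z hz
    dsimp at z hz
    obtain ⟨V₁, π₁, _, y, hy⟩ := surjective_up_to_refinements_of_epi (cokernel.π φ.τ₂) z
    have hy' : (y ≫ T.g) ≫ cokernel.π φ.τ₃ = 0 := by
      simpa [d, reassoc_of% hy] using π₁ ≫= hz
    obtain ⟨V₂, π₂, _, x, hx⟩ :=
      (CokernelCofork.IsColimit.comp_π_eq_zero_iff_up_to_refinements
        (cokernelIsCokernel φ.τ₃) (y ≫ T.g)).1 hy'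
    obtain ⟨V₃, π₃, _, x', hx'⟩ := surjective_up_to_refinements_of_epi S.g x
    obtain ⟨V₄, π₄, _, b, hb⟩ := hT.exact.exact_up_to_refinements
      (π₃ ≫ π₂ ≫ y - x' ≫ φ.τ₂) (by
        rw [Preadditive.sub_comp, Category.assoc, Category.assoc, Category.assoc, φ.comm₂₃, hx,
          reassoc_of% hx', sub_self])
    refine ⟨V₄, π₄ ≫ π₃ ≫ π₂ ≫ π₁, inferInstance, b ≫ cokernel.π φ.τ₁, ?_⟩
    have := hb =≫ cokernel.π φ.τ₂
    simpa [c, Preadditive.sub_comp, Preadditive.comp_sub, hy] using this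
  have : Mono (ShortComplex.mk c d hcd).f := ‹_›
  rw [← hex.lift_f g (h₃ _), h₁ (hex.lift g _), zero_comp]

lemma shortExact_subobject_ofLE {A : 𝒜} {X Y : Subobject A} (h : X ≤ Y) :
    (ShortComplex.mk (X.ofLE Y h) (cokernel.π _) (cokernel.condition _)).ShortExact where
  exact := ShortComplex.exact_cokernel _
  mono_f := inferInstanceAs (Mono (X.ofLE Y h))
  epi_g := inferInstanceAs (Epi (cokernel.π _))

/-- The morphism between subobjects that is induced by a morphism `f` which maps one to the
other. -/
noncomputable def subobjectMap {A B : 𝒜} (f : A ⟶ B) {X : Subobject A} {Y : Subobject B}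
    (h : imageSubobject (X.arrow ≫ f) ≤ Y) : (X : 𝒜) ⟶ (Y : 𝒜) :=
  factorThruImageSubobject (X.arrow ≫ f) ≫ Subobject.ofLE _ _ h

@[simp]
lemma subobjectMap_arrow {A B : 𝒜} (f : A ⟶ B) {X : Subobject A} {Y : Subobject B}
    (h : imageSubobject (X.arrow ≫ f) ≤ Y) : subobjectMap f h ≫ Y.arrow = X.arrow ≫ f := by
  simp [subobjectMap]

lemma ofLE_subobjectMap {A B : 𝒜} (f : A ⟶ B) {X X' : Subobject A} {Y Y' : Subobject B}
    (h : imageSubobject (X.arrow ≫ f) ≤ Y) (h' : imageSubobject (X'.arrow ≫ f) ≤ Y')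
    (hX : X ≤ X') (hY : Y ≤ Y') :
    X.ofLE X' hX ≫ subobjectMap f h' = subobjectMap f h ≫ Y.ofLE Y' hY := by
  simp [← cancel_mono Y'.arrow]

/-- A morphism of filtered objects is strict if there are no nonzero morphisms from kernels of
morphisms between graded pieces to cokernels of morphisms between graded pieces of lower index.
Here `P i` is a class of objects that contains the graded pieces of index `i`. -/
theorem filtration_strict {n : ℕ} (P : Fin n → ObjectProperty 𝒜)
    (hP : ∀ i j, i < j → ∀ (X Y X' Y' : 𝒜), P j X → P j Y → P i X' → P i Y' →
      ∀ (u : X ⟶ Y) (v : X' ⟶ Y') (g : kernel u ⟶ cokernel v), g = 0)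
    {A B : 𝒜} (FA : Fin (n + 1) → Subobject A) (FB : Fin (n + 1) → Subobject B)
    (hA : Monotone FA) (hB : Monotone FB) (hB₀ : FB 0 = ⊥)
    (hA₁ : FA (Fin.last n) = ⊤) (hB₁ : FB (Fin.last n) = ⊤)
    (hPA : ∀ i : Fin n, P i (cokernel
      ((FA i.castSucc).ofLE (FA i.succ) (hA (Fin.castSucc_le_succ i)))))
    (hPB : ∀ i : Fin n, P i (cokernel
      ((FB i.castSucc).ofLE (FB i.succ) (hB (Fin.castSucc_le_succ i)))))
    (f : A ⟶ B) (hf : ∀ i, imageSubobject ((FA i).arrow ≫ f) ≤ FB i) (i : Fin (n + 1)) :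
    FB i ⊓ imageSubobject f = imageSubobject ((FA i).arrow ≫ f) := by
  let S (i : Fin n) : ShortComplex 𝒜 := ShortComplex.mk
    ((FA i.castSucc).ofLE (FA i.succ) (hA (Fin.castSucc_le_succ i))) (cokernel.π _)
    (cokernel.condition _)
  let T (i : Fin n) : ShortComplex 𝒜 := ShortComplex.mk
    ((FB i.castSucc).ofLE (FB i.succ) (hB (Fin.castSucc_le_succ i))) (cokernel.π _)
    (cokernel.condition _)
  have hS (i : Fin n) : (S i).ShortExact := shortExact_subobject_ofLE _
  have hT (i : Fin n) : (T i).ShortExact := shortExact_subobject_ofLE _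
  let φ (i : Fin n) : S i ⟶ T i :=
    { τ₁ := subobjectMap f (hf i.castSucc)
      τ₂ := subobjectMap f (hf i.succ)
      τ₃ := cokernel.map _ _ (subobjectMap f (hf i.castSucc)) (subobjectMap f (hf i.succ))
        (ofLE_subobjectMap f _ _ _ _)
      comm₁₂ := (ofLE_subobjectMap f _ _ _ _).symm
      comm₂₃ := (cokernel.π_desc _ _ _).symm }
  -- Here `j : Fin n` indexes the piece `F_(j+1) / F_j`, so `i ≤ j.castSucc` says that this piece
  -- lies above `F_i`. For the snake lemma only `j = i` matters; the induction below needs all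
  -- larger `j`.
  have mono_of (i : Fin n) (h : ∀ j : Fin n, i.castSucc ≤ j.castSucc → ∀ (X Y : 𝒜), P j X →
      P j Y → ∀ (u : X ⟶ Y) (g : kernel u ⟶ cokernel (subobjectMap f (hf i.castSucc))), g = 0) :
      Mono (cokernel.map (φ i).τ₁ (φ i).τ₂ (S i).f (T i).f (φ i).comm₁₂) :=
    mono_cokernelMap_of_hom_eq_zero (hS i) (hT i) (φ i)
      (h i le_rfl _ _ (hPA i) (hPB i) _)
  -- Injectivity and vanishing are proved in alternation: vanishing into the cokernel at `i` makes
  -- its map to the next cokernel mono, and then `hP` carries the vanishing to `i + 1`.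
  have hom_zero (i : Fin (n + 1)) : ∀ j : Fin n, i ≤ j.castSucc → ∀ (X Y : 𝒜), P j X →
      P j Y → ∀ (u : X ⟶ Y) (g : kernel u ⟶ cokernel (subobjectMap f (hf i))), g = 0 := by
    induction i using Fin.induction with
    | zero =>
      intro j _ X Y _ _ u g
      have h0 : (FB 0).arrow = 0 := by rw [hB₀]; exact Subobject.bot_arrow
      have h1 : cokernel.π (subobjectMap f (hf 0)) = 0 := by
        have : (𝟙 ((FB 0 : Subobject B) : 𝒜)) = 0 := by
          rw [← cancel_mono (FB 0).arrow, h0, comp_zero, comp_zero]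
        rw [← Category.id_comp (cokernel.π _), this, zero_comp]
      have h2 : 𝟙 (cokernel (subobjectMap f (hf 0))) = 0 := by
        rw [← cancel_epi (cokernel.π _), h1, zero_comp, zero_comp]
      rw [← Category.comp_id g, h2, comp_zero]
    | succ i ih =>
      intro j hj X Y hX hY u
      have := mono_of i ih
      have := (hS i).epi_g
      have hij : i < j := Fin.succ_le_castSucc_iff.1 hj
      exact hom_cokernel_eq_zero (hT i) (φ i) (ih j (Fin.castSucc_le_castSucc_iff.2 hij.le)
        X Y hX hY u) (hP i j hij X Y _ _ hX hY (hPA i) (hPB i) u _)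
  -- Descending induction: the map to `cokernel f` is a composite of the monomorphisms between
  -- consecutive cokernels, and at the top index it is an isomorphism.
  have mono_to (i : Fin (n + 1)) : Mono (cokernel.map (subobjectMap f (hf i)) f (FA i).arrow
      (FB i).arrow (subobjectMap_arrow f _)) := by
    induction i using Fin.reverseInduction with
    | last =>
      have : IsIso (FA (Fin.last n)).arrow := by rw [hA₁]; infer_instance
      have : IsIso (FB (Fin.last n)).arrow := by rw [hB₁]; infer_instance
      infer_instance
    | cast i ih =>
      have := mono_of i (hom_zero i.castSucc)
      have : cokernel.map (subobjectMap f (hf i.castSucc)) f (FA i.castSucc).arrow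
          (FB i.castSucc).arrow (subobjectMap_arrow f _) =
          cokernel.map (φ i).τ₁ (φ i).τ₂ (S i).f (T i).f (φ i).comm₁₂ ≫
          cokernel.map (subobjectMap f (hf i.succ)) f (FA i.succ).arrow
          (FB i.succ).arrow (subobjectMap_arrow f _) := by
        rw [← cancel_epi (cokernel.π _)]
        simp [φ, T]
      rw [this]
      exact mono_comp _ _
  refine le_antisymm ?_ (le_inf (hf i) (imageSubobject_comp_le _ _))
  have := mono_to i
  let Q : Subobject B := FB i ⊓ imageSubobject f
  let y : (Q : 𝒜) ⟶ (FB i : 𝒜) := Q.ofLE _ inf_le_left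
  have hy : y ≫ (FB i).arrow = Q.arrow := Subobject.ofLE_arrow _
  have hy₀ : y ≫ cokernel.π (subobjectMap f (hf i)) = 0 := by
    rw [← cancel_mono (cokernel.map (subobjectMap f (hf i)) f (FA i).arrow
      (FB i).arrow (subobjectMap_arrow f _)), Category.assoc, cokernel.map, cokernel.π_desc,
      reassoc_of% hy, zero_comp, ← Subobject.ofLE_arrow (inf_le_right : Q ≤ imageSubobject f),
      Category.assoc, imageSubobject_arrow_comp_eq_zero (cokernel.condition f), comp_zero]
  obtain ⟨W, π, _, x, hx⟩ :=
    (CokernelCofork.IsColimit.comp_π_eq_zero_iff_up_to_refinements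
      (cokernelIsCokernel (subobjectMap f (hf i))) y).1 hy₀
  have hW : π ≫ Q.arrow = x ≫ (FA i).arrow ≫ f := by
    rw [← hy, reassoc_of% hx, subobjectMap_arrow]
  -- The factorization through the image exists only after the cover `π`; lifting `π` against the
  -- mono `arrow` removes the cover.
  have : StrongEpi π := strongEpi_of_epi π
  have hsq : CommSq (x ≫ factorThruImageSubobject ((FA i).arrow ≫ f)) π
      (imageSubobject ((FA i).arrow ≫ f)).arrow Q.arrow := ⟨by simp [hW]⟩
  exact Subobject.le_of_comm hsq.lift hsq.fac_right

end CategoryTheory.Abelian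

/-! ### Triangles from exact sequences in the heart -/

namespace BridgelandStability

universe v u

variable {C : Type u} [Category.{v} C] [Preadditive C] [HasZeroObject C] [HasShift C ℤ]
  [∀ n : ℤ, (shiftFunctor C n).Additive] [Pretriangulated C]

namespace Slicing

variable {S : Slicing C}

lemma ofPhases_of_semistable {I : Set ℝ} {φ : ℝ} (hφ : φ ∈ I) {E : C} (hE : S.P φ E) :
    S.ofPhases I E := by
  by_cases h : IsZero E
  · exact ofPhases_of_isZero I h
  · exact ofPhases_snoc (I := ∅) (E := 0) (ψ := φ) (ofPhases_of_isZero _ (isZero_zero C))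
      ⟨_, _, _, contractible_distinguished₁ E⟩ hE h (fun x hx => hx.elim)
      (Set.empty_subset I) hφ

lemma ofPhases_Ioi_of_le {s t : ℝ} (h : s ≤ t) {E : C} (hE : S.ofPhases (Set.Ioi t) E) :
    S.ofPhases (Set.Ioi s) E :=
  ofPhases_mono (Set.Ioi_subset_Ioi h) hE

lemma ofPhases_Iic_of_le {s t : ℝ} (h : s ≤ t) {E : C} (hE : S.ofPhases (Set.Iic s) E) :
    S.ofPhases (Set.Iic t) E :=
  ofPhases_mono (Set.Iic_subset_Iic.2 h) hE

lemma ofPhases_Ioi_shift {t : ℝ} (n : ℤ) {E : C} (hE : S.ofPhases (Set.Ioi t) E) :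
    S.ofPhases (Set.Ioi (t + n)) (E⟦n⟧) :=
  ofPhases_shift n (fun x hx => by simpa using hx) hE

lemma ofPhases_Iic_shift {t : ℝ} (n : ℤ) {E : C} (hE : S.ofPhases (Set.Iic t) E) :
    S.ofPhases (Set.Iic (t + n)) (E⟦n⟧) :=
  ofPhases_shift n (fun x hx => by simpa using hx) hE

section

variable [IsTriangulated C] (S)

/-- The epimorphism fits into a distinguished triangle whose first term is in the heart and is a
kernel of it, so it is isomorphic to `T.X₁`. -/
lemma isExt_of_shortExact {T : ShortComplex S.heart.FullSubcategory} (hT : T.ShortExact) :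
    IsExt T.X₁.obj T.X₂.obj T.X₃.obj := by
  have := hT.epi_g
  have := hT.mono_f
  obtain ⟨K, i, δ, h⟩ := Triangulated.AbelianSubcategory.exists_distinguished_triangle_of_epi
    (heart_hom_shift_eq_zero S) (heart_admissible S) T.g
  have hK := Triangulated.AbelianSubcategory.isLimitKernelForkOfDistTriang
    (heart_hom_shift_eq_zero S) i T.g δ h
  let e : K ≅ T.X₁ := IsLimit.conePointUniqueUpToIso hK hT.fIsKernel
  exact IsExt.of_iso ⟨_, _, _, h⟩ (S.heart.ι.mapIso e) (Iso.refl _)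

lemma exists_isExt_image {X Y : S.heart.FullSubcategory} (u : X ⟶ Y) :
    ∃ I : C, S.heart I ∧ IsExt (kernel u).obj X.obj I ∧ IsExt I Y.obj (cokernel u).obj := by
  have h₁ : (ShortComplex.mk (kernel.ι u) (Abelian.coimage.π u)
      (cokernel.condition _)).ShortExact :=
    { exact := ShortComplex.exact_cokernel _
      mono_f := inferInstanceAs (Mono (kernel.ι u))
      epi_g := inferInstanceAs (Epi (Abelian.coimage.π u)) }
  have h₂ : (ShortComplex.mk (Abelian.image.ι u) (cokernel.π u)
      (kernel.condition _)).ShortExact :=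
    { exact := ShortComplex.exact_kernel _
      mono_f := inferInstanceAs (Mono (Abelian.image.ι u))
      epi_g := inferInstanceAs (Epi (cokernel.π u)) }
  exact ⟨_, (Abelian.coimage u).property, isExt_of_shortExact S h₁,
    (isExt_of_shortExact S h₂).of_iso
      (S.heart.ι.mapIso (Abelian.coimageIsoImage u).symm) (Iso.refl _)⟩

end

end Slicing

open Slicing

/-! ### Additivity and signs of the rotated central charge -/

lemma K0.of_isExt {X Y Z : C} (h : IsExt X Y Z) : K0.of Y = K0.of X + K0.of Z := by
  obtain ⟨f, g, k, hT⟩ := h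
  have : (QuotientAddGroup.mk (FreeAbelianGroup.of Y -
      (FreeAbelianGroup.of X + FreeAbelianGroup.of Z)) : K0 C) = 0 :=
    (QuotientAddGroup.eq_zero_iff _).2 (AddSubgroup.subset_closure ⟨_, hT, rfl⟩)
  exact sub_eq_zero.1 this

/-- For a zero object, `X ⟶ X ⟶ X` is distinguished, so its class equals twice itself. -/
lemma K0.of_isZero {X : C} (h : IsZero X) : K0.of X = 0 := by
  have hT : IsExt X X X := ⟨𝟙 X, 0, 0, isomorphic_distinguished _ (contractible_distinguished X) _
    (Triangle.isoMk _ _ (Iso.refl _) (Iso.refl _) h.isoZero rfl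
      ((isZero_zero C).eq_of_tgt _ _) (h.eq_of_src _ _))⟩
  have := K0.of_isExt hT
  simpa using this

namespace StabilityCondition

variable {Γ : Type*} [AddCommGroup Γ] {cl : K0 C →+ Γ} (σ : StabilityCondition cl)

/-- The imaginary part of the central charge after a rotation which maps the ray of phase `t`
to the positive real axis. -/
noncomputable def rotatedIm (t : ℝ) (E : C) : ℝ :=
  (σ.Z (cl (K0.of E)) * Complex.exp (-(Real.pi * Complex.I * t))).im

lemma rotatedIm_of_isExt (t : ℝ) {X Y Z : C} (h : IsExt X Y Z) :
    σ.rotatedIm t Y = σ.rotatedIm t X + σ.rotatedIm t Z := by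
  simp [rotatedIm, K0.of_isExt h, add_mul]

lemma rotatedIm_of_isZero (t : ℝ) {X : C} (h : IsZero X) : σ.rotatedIm t X = 0 := by
  simp [rotatedIm, K0.of_isZero h]

lemma rotatedIm_add_one (t : ℝ) (X : C) : σ.rotatedIm (t + 1) X = - σ.rotatedIm t X := by
  have : Complex.exp (-(Real.pi * Complex.I * (t + 1 : ℝ))) =
      - Complex.exp (-(Real.pi * Complex.I * t)) := by
    rw [show (-(Real.pi * Complex.I * (t + 1 : ℝ)) : ℂ) =
      -(Real.pi * Complex.I * t) - Real.pi * Complex.I by push_cast; ring,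
      Complex.exp_sub, Complex.exp_pi_mul_I, div_neg, div_one]
  rw [rotatedIm, rotatedIm, this, mul_neg, Complex.neg_im]

lemma continuous_rotatedIm (X : C) : Continuous fun t => σ.rotatedIm t X := by
  unfold rotatedIm
  fun_prop

lemma exists_rotatedIm_eq (t : ℝ) {φ : ℝ} {E : C} (hE : σ.P φ E) (hE' : ¬ IsZero E) :
    ∃ r : ℝ, 0 < r ∧ σ.rotatedIm t E = r * Real.sin (Real.pi * (φ - t)) := by
  obtain ⟨r, hr, h⟩ := σ.charge φ E hE hE'
  refine ⟨r, hr, ?_⟩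
  rw [rotatedIm, h, mul_assoc, ← Complex.exp_add,
    show (Real.pi * Complex.I * φ + -(Real.pi * Complex.I * t) : ℂ) =
      ((Real.pi * (φ - t) : ℝ) : ℂ) * Complex.I by push_cast; ring,
    Complex.im_ofReal_mul, Complex.exp_ofReal_mul_I_im]

lemma rotatedIm_nonneg {t : ℝ} {I : Set ℝ} (hI : ∀ x ∈ I, t ≤ x ∧ x ≤ t + 1) {E : C}
    (hE : σ.ofPhases I E) : 0 ≤ σ.rotatedIm t E := by
  refine ofPhases_induction (motive := fun I E => (∀ x ∈ I, t ≤ x ∧ x ≤ t + 1) →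
    0 ≤ σ.rotatedIm t E) ?_ ?_ hE hI
  · intro I E h _
    rw [σ.rotatedIm_of_isZero t h]
  · intro I E' E A ψ hψ hA hA' hT _ ih hI
    obtain ⟨r, hr, h⟩ := σ.exists_rotatedIm_eq t hA hA'
    have h₁ := ih fun x hx => hI x hx.1
    have h₂ : 0 ≤ Real.sin (Real.pi * (ψ - t)) := Real.sin_nonneg_of_nonneg_of_le_pi
      (mul_nonneg Real.pi_pos.le (by linarith [hI ψ hψ]))
      (mul_le_of_le_one_right Real.pi_pos.le (by linarith [hI ψ hψ]))
    rw [σ.rotatedIm_of_isExt t hT, h]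
    positivity

lemma rotatedIm_pos {t : ℝ} {I : Set ℝ} (hI : ∀ x ∈ I, t < x ∧ x < t + 1) {E : C}
    (hE : σ.ofPhases I E) (hE' : ¬ IsZero E) : 0 < σ.rotatedIm t E := by
  refine ofPhases_induction (motive := fun I E => (∀ x ∈ I, t < x ∧ x < t + 1) →
    ¬ IsZero E → 0 < σ.rotatedIm t E) ?_ ?_ hE hI hE'
  · intro I E h _ h'
    exact absurd h h'
  · intro I E' E A ψ hψ hA hA' hT hE' _ hI _
    obtain ⟨r, hr, h⟩ := σ.exists_rotatedIm_eq t hA hA'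
    have h₁ := σ.rotatedIm_nonneg (t := t) (fun x hx => ⟨(hI x hx.1).1.le, (hI x hx.1).2.le⟩) hE'
    have h₂ : 0 < Real.sin (Real.pi * (ψ - t)) := Real.sin_pos_of_pos_of_lt_pi
      (mul_pos Real.pi_pos (by linarith [hI ψ hψ]))
      (mul_lt_of_lt_one_right Real.pi_pos (by linarith [hI ψ hψ]))
    rw [σ.rotatedIm_of_isExt t hT, h]
    positivity

/-- Truncation controls phases `> s`, not phases `≥ φ`. Letting `s` tend to `φ` from below and using
continuity in the angle replaces the closed bound. -/
lemma rotatedIm_nonneg_of_forall_lt {a φ : ℝ} (ha : a < φ) {E : C}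
    (hE : ∀ s, a < s → s < φ → σ.ofPhases (Set.Ioc s (a + 1)) E) : 0 ≤ σ.rotatedIm φ E := by
  refine ge_of_tendsto (x := nhdsWithin φ (Set.Iio φ))
    ((σ.continuous_rotatedIm E).tendsto φ |>.mono_left nhdsWithin_le_nhds) ?_
  filter_upwards [Ioo_mem_nhdsLT ha] with s hs
  exact σ.rotatedIm_nonneg (fun x hx => ⟨hx.1.le, by linarith [hx.2, hs.1]⟩) (hE s hs.1 hs.2)

/-! ### Phases of kernels and cokernels of maps between semistable objects -/

variable [IsTriangulated C]

/-- Let `Q'` be the part of the kernel with phases at most `s`, and `K'` the rest. The quotient `D =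
X / K'` is an extension of the image `I` by `Q'`. As a quotient of `X` it has phases above every `r
< t`, so its charge is not below the ray of phase `t`. But `I`, a subobject of `Y`, has phases at
most `t`, and a nonzero `Q'` would push the sum strictly below. -/
lemma kernel_ofPhases_Ioi {s t : ℝ} (hs : 0 ≤ s) (hst : s < t) (ht : t ≤ 1)
    {X Y : σ.heart.FullSubcategory} (hX : σ.P t X.obj) (hY : σ.P t Y.obj) (u : X ⟶ Y) :
    σ.ofPhases (Set.Ioi s) (kernel u).obj := by
  obtain ⟨I, hI, hKI, hIQ⟩ := exists_isExt_image σ.toSlicing u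
  obtain ⟨K', Q', hK', hQ', hT⟩ := exists_truncation s (kernel u).property
  have hI' : σ.ofPhases (Set.Ioc 0 t) I := (ofPhases_Ioc_iff _ _ _).2
    ⟨((ofPhases_Ioc_iff _ _ _).1 hI).1, hIQ.invRotate.Iic_mem
      (ofPhases_Iic_of_le (by norm_num; linarith) (ofPhases_Iic_shift (-1)
        ((ofPhases_Ioc_iff _ _ _).1 (cokernel u).property).2))
      (ofPhases_of_semistable Set.self_mem_Iic hY)⟩
  have hT' := hT
  obtain ⟨a, b, c, hdist⟩ := hT'
  obtain ⟨D, _, _, _, hD, hQD⟩ := IsExt.octahedron hdist hKI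
  have hD₁ : σ.ofPhases (Set.Iic 1) D := hQD.Iic_mem (ofPhases_mono (fun x hx => hx.1.2) hQ')
    ((ofPhases_Ioc_iff _ _ _).1 hI).2
  have hXD : IsExt X.obj D (K'⟦(1 : ℤ)⟧) := IsExt.rotate ⟨_, _, _, hD⟩
  have hD₂ : 0 ≤ σ.rotatedIm t D := by
    refine σ.rotatedIm_nonneg_of_forall_lt (a := 0) (by linarith) fun r hr hrt => ?_
    rw [zero_add]
    refine (ofPhases_Ioc_iff _ _ _).2 ⟨hXD.Ioi_mem (ofPhases_of_semistable hrt hX) ?_, hD₁⟩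
    exact ofPhases_Ioi_of_le (by norm_num; linarith) (ofPhases_Ioi_shift (t := 0) 1
      (ofPhases_mono (fun x hx => hx.1.1) hK'))
  have h₁ := σ.rotatedIm_of_isExt t hQD
  -- The phases of `I` and `Q'` lie in `(t - 1, t]`, where the height over `t - 1` is nonnegative; a
  -- half turn changes its sign.
  have h₂ := σ.rotatedIm_add_one (t - 1) I
  have h₃ := σ.rotatedIm_add_one (t - 1) Q'
  rw [sub_add_cancel] at h₂ h₃
  have h₄ := σ.rotatedIm_nonneg (t := t - 1)
    (fun x hx => ⟨by linarith [hx.1], by linarith [hx.2]⟩) hI'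
  have hQ₀ : IsZero Q' := by
    by_contra h
    have := σ.rotatedIm_pos (t := t - 1) (fun x hx => ⟨by linarith [hx.1.1],
      by have : x ≤ s := hx.2
         linarith⟩) hQ' h
    linarith
  exact hT.Ioi_mem (ofPhases_mono (fun x hx => hx.2) hK') (ofPhases_of_isZero _ hQ₀)

/-- Dual argument. If `Q'` is the part of the cokernel with phases above `t`, the kernel of `Y ⟶
Q''` is an extension of `Q'` by the image `I`. Its phases are at most `t`, as for a subobject of
`Y`, while `I`, a quotient of `X`, contributes no negative height over `t` and a nonzero `Q'`
contributes positive height. -/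
lemma cokernel_ofPhases_Iic {t : ℝ} (ht₀ : 0 < t) (ht : t ≤ 1)
    {X Y : σ.heart.FullSubcategory} (hX : σ.P t X.obj) (hY : σ.P t Y.obj) (u : X ⟶ Y) :
    σ.ofPhases (Set.Iic t) (cokernel u).obj := by
  obtain ⟨I, hI, hKI, hIQ⟩ := exists_isExt_image σ.toSlicing u
  obtain ⟨Q', Q'', hQ', hQ'', hT⟩ := exists_truncation t (cokernel u).property
  have hI₁ := (ofPhases_Ioc_iff _ _ _).1 hI
  have hI₂ : ∀ r < t, σ.ofPhases (Set.Ioi r) I := fun r hr =>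
    hKI.rotate.Ioi_mem (ofPhases_of_semistable hr hX)
      (ofPhases_Ioi_of_le (by norm_num; linarith) (ofPhases_Ioi_shift 1
        ((ofPhases_Ioc_iff _ _ _).1 (kernel u).property).1))
  obtain ⟨a, b, c, hdist⟩ := hIQ
  -- The octahedron for `Y ⟶ coker u ⟶ Q''` gives `D` as a cone, so it is the kernel of the
  -- composite shifted by one; all phases below are raised by `1` accordingly.
  obtain ⟨D, _, _, _, hD, hID⟩ := IsExt.octahedron (rot_of_distTriang _ hdist) hT.rotate
  replace hID : IsExt (I⟦(1 : ℤ)⟧) D (Q'⟦(1 : ℤ)⟧) := hID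
  have hYD : IsExt Q'' D (Y.obj⟦(1 : ℤ)⟧) := IsExt.rotate ⟨_, _, _, hD⟩
  have hD₁ : σ.ofPhases (Set.Iic (t + 1)) D := hYD.Iic_mem
    (ofPhases_mono (fun x hx => by
      have : x ≤ t := hx.2
      simp only [Set.mem_Iic]
      linarith) hQ'')
    (ofPhases_shift 1 (fun x hx => by simpa using hx)
      (ofPhases_of_semistable (I := Set.Iic t) Set.self_mem_Iic hY))
  have hD₂ : σ.ofPhases (Set.Ioi 1) D := hID.Ioi_mem
    (ofPhases_shift 1 (fun x hx => by simpa using hx) hI₁.1)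
    (ofPhases_shift 1 (fun x hx => by simpa using hx.1.1) hQ')
  have h₀ := σ.rotatedIm_nonneg (t := t)
    (fun x hx => ⟨by linarith [hx.1], by linarith [hx.2]⟩)
    ((ofPhases_Ioc_iff _ _ _).2 ⟨hD₂, hD₁⟩)
  have h₁ := σ.rotatedIm_of_isExt t hID
  have h₂ := σ.rotatedIm_add_one t (I⟦(1 : ℤ)⟧)
  have h₃ := σ.rotatedIm_add_one t (Q'⟦(1 : ℤ)⟧)
  have h₄ : 0 ≤ σ.rotatedIm (t + 1) (I⟦(1 : ℤ)⟧) := by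
    refine σ.rotatedIm_nonneg_of_forall_lt (a := 1) (by linarith) fun r hr hrt => ?_
    refine ofPhases_shift 1 (I := Set.Ioc (r - 1) 1) (fun x hx => ?_)
      ((ofPhases_Ioc_iff _ _ _).2 ⟨hI₂ (r - 1) (by linarith), hI₁.2⟩)
    simp only [Set.mem_Ioc, Int.cast_one] at hx ⊢
    constructor <;> linarith
  have hQ₀ : IsZero Q' := by
    by_contra h
    have := σ.rotatedIm_pos (t := t + 1) (I := Set.Ioc (t + 1) 2)
      (fun x hx => ⟨hx.1, by linarith [hx.2]⟩)
      (ofPhases_shift 1 (fun x hx => by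
        have h₁ : t < x := hx.2
        have h₂ : x ≤ 1 := hx.1.2
        simp only [Set.mem_Ioc, Int.cast_one]
        constructor <;> linarith) hQ') (fun h' => h (by
          rw [IsZero.iff_id_eq_zero] at h' ⊢
          apply (shiftFunctor C (1 : ℤ)).map_injective
          rw [CategoryTheory.Functor.map_id, CategoryTheory.Functor.map_zero]
          exact h'))
    linarith
  exact hT.Iic_mem (ofPhases_of_isZero _ hQ₀) (ofPhases_mono (fun x hx => hx.2) hQ'')

lemma kernel_hom_cokernel_eq_zero {s t : ℝ} (hs : 0 < s) (hst : s < t) (ht : t ≤ 1)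
    {X Y X' Y' : σ.heart.FullSubcategory} (hX : σ.P t X.obj) (hY : σ.P t Y.obj)
    (hX' : σ.P s X'.obj) (hY' : σ.P s Y'.obj) (u : X ⟶ Y) (v : X' ⟶ Y')
    (g : kernel u ⟶ cokernel v) : g = 0 :=
  σ.heart.ι.map_injective <| (hom_eq_zero_of_ofPhases
    (fun _ hx _ hy => lt_of_le_of_lt hy hx) (σ.kernel_ofPhases_Ioi hs.le hst ht hX hY u)
    (σ.cokernel_ofPhases_Iic hs (hst.le.trans ht) hX' hY' v) _).trans
    (σ.heart.ι.map_zero _ _).symm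

end StabilityCondition

end BridgelandStability

open BridgelandStability in
theorem mainTheorem9 {C : Type*} [Category* C] [Preadditive C] [HasZeroObject C]
    [HasShift C ℤ] [∀ n : ℤ, (shiftFunctor C n).Additive] [Pretriangulated C] [IsTriangulated C]
    {Γ : Type*} [AddCommGroup Γ] [Module.Finite ℝ (ℝ ⊗[ℤ] Γ)] (cl : K0 C →+ Γ)
    (σ : StabilityCondition cl) {n : ℕ} (φ : Fin n → ℝ) (hφ : StrictMono φ)
    (hφ' : ∀ i, 0 < φ i ∧ φ i ≤ 1) {A B : σ.heart.FullSubcategory}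
    (FA : SemistableFiltration σ φ A) (FB : SemistableFiltration σ φ B) (f : A ⟶ B)
    (hf : ∀ i, imageSubobject ((FA.F i).arrow ≫ f) ≤ FB.F i) :
    ∀ i, FB.F i ⊓ imageSubobject f = imageSubobject ((FA.F i).arrow ≫ f) := by
  exact Abelian.filtration_strict (fun i X => σ.P (φ i) X.obj)
    (fun i j hij X Y X' Y' hX hY hX' hY' => σ.kernel_hom_cokernel_eq_zero (hφ' i).1 (hφ hij)
      (hφ' j).2 hX hY hX' hY') FA.F FB.F FA.mono FB.mono FB.zero FA.last FB.last
    FA.semistable FB.semistable f hf
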